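/- Let $n\ge 1$ and let $p\in\mathbb{C}[x_1,\dots,x_n]$ be a polynomial with integer coefficients and zero constant term. An algorithm in the traditional model of complex arithmetic is a finite program without constants. It starts from the exact inputs $x_1,\dots,x_n$. Each step either negates an available value exactly, or applies one of the operations $+,-,\times$ to two available values $a,b$ and returns $\mathrm{op}(a,b)(1+\delta_i)$, where every such operation performed has its own rounding error $\delta_i\in\mathbb{C}$, or branches according to whether two available values satisfy a relation taken from a given set $T$ of binary relations on $\mathbb{C}$ (the comparisons; $T=\emptyset$ means no branching). Finally it outputs one of the available values, $p_{comp}(x,\delta)$. The polynomial $p$ is accurately evaluable on $\mathbb{C}^n$ (with comparisons $T$) if there is such an algorithm with $p_{comp}(x,0)=p(x)$ for all $x\in\mathbb{C}^n$ and such that for every $0<\eta<1$ there is $0<\epsilon<1$ with $$|p_{comp}(x,\delta)-p(x)|\le \eta\,|p(x)|\quad\text{for all } x\in\mathbb{C}^n \text{ and all } \delta \text{ with } |\delta_i|\le\epsilon \text{ for all } i .$$ The variety $V(p)=\{x\in\mathbb{C}^n: p(x)=0\}$ is allowable if it is a union of intersections of hyperplanes of the forms $\{x_i=0\}$, $\{x_i+x_j=0\}$,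 $\{x_i-x_j=0\}$ with $i\ne j$ (the empty intersection being $\mathbb{C}^n$). Then, for every set $T$ of comparisons (in particular both with and without branching), $p$ is accurately evaluable on $\mathbb{C}^n$ if and only if $V(p)$ is allowable. In that case there are an integer $c$ and nonnegative integers $a_i$, $s_{ij}$, $d_{ij}$ such that $$p=c\,\prod_{i} x_i^{a_i}\,\prod_{i<j}(x_i+x_j)^{s_{ij}}(x_i-x_j)^{d_{ij}} .$$ -/

import Mathlib

namespace AccurateEval

/-- The rounded binary operations of traditional arithmetic. -/
inductive ArithOp
  | add
  | sub
  | mul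

/-- The exact result of an operation, before rounding. -/
def ArithOp.exact : ArithOp → ℂ → ℂ → ℂ
  | .add, a, b => a + b
  | .sub, a, b => a - b
  | .mul, a, b => a * b

/-- `Algorithm T m` is a finite algorithm in traditional arithmetic (no constants) that has `m`
values at its disposal: the inputs and the results of the steps made so far. Each computational
step names its operands among the available values, which may be reused any number of times, and
appends its result to them. A branching step compares two available values by one of the relations
in `T`; there is no branching when `T = ∅`. -/
inductive Algorithm (T : Set (ℂ → ℂ → Prop)) : ℕ → Type
  | output {m : ℕ} (a : Fin m) : Algorithm T m
  | neg {m : ℕ} (a : Fin m) (next : Algorithm T (m + 1)) : Algorithm T m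
  | arith {m : ℕ} (o : ArithOp) (a b : Fin m) (next : Algorithm T (m + 1)) : Algorithm T m
  | branch {m : ℕ} (R : ℂ → ℂ → Prop) (hR : R ∈ T) (a b : Fin m)
      (ifTrue ifFalse : Algorithm T m) : Algorithm T m

open Classical in
/-- The output of an algorithm on the values `v` with rounding errors `δ`. Negation is exact. The
operation whose result becomes the value number `m` has its result multiplied by `1 + δ m`, so
that the operations made in one run have their own, mutually independent, rounding errors. -/
noncomputable def Algorithm.run {T : Set (ℂ → ℂ → Prop)} (δ : ℕ → ℂ) :
    {m : ℕ} → Algorithm T m → (Fin m → ℂ) → ℂ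
  | _, .output a, v => v a
  | _, .neg a next, v => next.run δ (Fin.snoc v (-(v a)))
  | m, .arith o a b next, v => next.run δ (Fin.snoc v (o.exact (v a) (v b) * (1 + δ m)))
  | _, .branch R _ a b ifTrue ifFalse, v =>
      if R (v a) (v b) then ifTrue.run δ v else ifFalse.run δ v

/-- The algorithm evaluates `p` accurately on `D`. -/
def Algorithm.IsAccurate {T : Set (ℂ → ℂ → Prop)} {n : ℕ} (A : Algorithm T n)
    (p : MvPolynomial (Fin n) ℂ) (D : Set (Fin n → ℂ)) : Prop :=
  (∀ x ∈ D, A.run 0 x = MvPolynomial.eval x p) ∧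
  ∀ η : ℝ, 0 < η → η < 1 → ∃ ε : ℝ, 0 < ε ∧ ε < 1 ∧
    ∀ x ∈ D, ∀ δ : ℕ → ℂ, (∀ i, ‖δ i‖ ≤ ε) →
      ‖A.run δ x - MvPolynomial.eval x p‖ ≤ η * ‖MvPolynomial.eval x p‖

/-- `p` is accurately evaluable on `D` in traditional arithmetic, with branching on comparisons
by the relations in `T`. -/
def AccuratelyEvaluable (T : Set (ℂ → ℂ → Prop)) {n : ℕ} (p : MvPolynomial (Fin n) ℂ)
    (D : Set (Fin n → ℂ)) : Prop :=
  ∃ A : Algorithm T n, A.IsAccurate p D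

/-- The variety of `p`. -/
def variety {n : ℕ} (p : MvPolynomial (Fin n) ℂ) : Set (Fin n → ℂ) :=
  {x | MvPolynomial.eval x p = 0}

/-- The hyperplanes `x_i = 0`, `x_i + x_j = 0` and `x_i - x_j = 0` in `ℂⁿ`. -/
def allowableHyperplanes (n : ℕ) : Set (Set (Fin n → ℂ)) :=
  {H | (∃ i, H = {x | x i = 0}) ∨
    (∃ i j, i ≠ j ∧ H = {x | x i + x j = 0}) ∨
    (∃ i j, i ≠ j ∧ H = {x | x i - x j = 0})}

/-- `V` is a union of intersections of allowable hyperplanes; the intersection of no hyperplanes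
is the whole space. There are only finitely many allowable hyperplanes, so all the unions and
intersections here are finite. -/
def IsAllowable {n : ℕ} (V : Set (Fin n → ℂ)) : Prop :=
  ∃ F : Set (Set (Set (Fin n → ℂ))),
    (∀ W ∈ F, W ⊆ allowableHyperplanes n) ∧ V = ⋃ W ∈ F, ⋂₀ W

end AccurateEval

/-! ### Necessity: rigid families of values and generic rounding errors. -/

namespace AccurateEval

open Filter Topology

/-! Necessity: let `p` vanish at `x`, and let `W` be the intersection of the allowable hyperplanes
through `x`. Generic small rounding errors create no coincidences at `x` beyond those forced on all
of `W` (`ZeroRigid`), so a computed value that vanishes at `x` vanishes on `W`. If `p` were nonzero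
at some point of `W`, then it would be nonzero at points of `W` arbitrarily close to `x`. Along an
ultrafilter of such points every branch is decided, so the output is a continuous `f`; accuracy
forces `f x = 0`, hence `f = 0` on `W`, which contradicts a relative error of at most 1/2. So `W`
lies in the variety, which is thus a union of such intersections.

Sufficiency: if `p ≠ 0`, the product of all the linear forms vanishes on the variety, so by the
Nullstellensatz `p` divides a power of it, and unique factorization makes `p` a constant times a
product of forms. That product is monic for the lexicographic order, so the constant is a
coefficient of `p`, hence an integer. Such a product is computed without cancellation, except
between exact inputs. -/

/-- The run of an algorithm with `m` values uses only the rounding errors of index at least `m`. -/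
theorem Algorithm.run_congr {T : Set (ℂ → ℂ → Prop)} {m : ℕ} (A : Algorithm T m)
    {δ δ' : ℕ → ℂ} (h : ∀ i, m ≤ i → δ i = δ' i) (v : Fin m → ℂ) :
    A.run δ v = A.run δ' v := by
  induction A with
  | output a => rfl
  | neg a next ih => exact ih (fun i hi => h i (by omega)) _
  | arith o a b next ih =>
    simp only [Algorithm.run]
    rw [h _ le_rfl]
    exact ih (fun i hi => h i (by omega)) _
  | branch R hR a b A B ihA ihB =>
    simp only [Algorithm.run]
    rw [ihA h, ihB h]

/-- Sums, differences and values of the family `v` that vanish at `x` vanish on all of `W`. -/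
structure ZeroRigid {n m : ℕ} (x : Fin n → ℂ) (W : Set (Fin n → ℂ))
    (v : (Fin n → ℂ) → Fin m → ℂ) : Prop where
  cont : ∀ a, Continuous fun y => v y a
  zero : ∀ a, v x a = 0 → ∀ y ∈ W, v y a = 0
  add : ∀ a b, v x a + v x b = 0 → ∀ y ∈ W, v y a + v y b = 0
  sub : ∀ a b, v x a - v x b = 0 → ∀ y ∈ W, v y a - v y b = 0

/-- Negation exchanges sums and differences, so the two conditions have to be carried together. -/
theorem ZeroRigid.snoc_neg {n m : ℕ} {x : Fin n → ℂ} {W : Set (Fin n → ℂ)}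
    {v : (Fin n → ℂ) → Fin m → ℂ} (h : ZeroRigid x W v) (a : Fin m) :
    ZeroRigid x W fun y => (Fin.snoc (v y) (-(v y a)) : Fin (m + 1) → ℂ) := by
  refine ⟨fun b => ?_, fun b => ?_, fun b c => ?_, fun b c => ?_⟩
  · cases b using Fin.lastCases with
    | last =>
      simp only [Fin.snoc_last]
      exact (h.cont a).neg
    | cast b => simpa using h.cont b
  · cases b using Fin.lastCases with
    | last => simpa using h.zero a
    | cast b => simpa using h.zero b
  · cases b using Fin.lastCases <;> cases c using Fin.lastCases
    · simpa [← two_mul] using h.zero a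
    · rename_i c
      simpa only [Fin.snoc_last, Fin.snoc_castSucc, neg_add_eq_sub] using h.sub c a
    · rename_i b
      simpa only [Fin.snoc_last, Fin.snoc_castSucc, ← sub_eq_add_neg] using h.sub b a
    · simpa using h.add _ _
  · cases b using Fin.lastCases <;> cases c using Fin.lastCases
    · simp
    · rename_i c
      simp only [Fin.snoc_last, Fin.snoc_castSucc]
      intro hx y hy
      linear_combination -(h.add a c (by linear_combination -hx) y hy)
    · rename_i b
      simpa only [Fin.snoc_last, Fin.snoc_castSucc, sub_neg_eq_add] using h.add b a
    · simpa using h.sub _ _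

theorem ZeroRigid.exact_eq_zero {n m : ℕ} {x : Fin n → ℂ} {W : Set (Fin n → ℂ)}
    {v : (Fin n → ℂ) → Fin m → ℂ} (h : ZeroRigid x W v) (o : ArithOp) (a b : Fin m)
    (hx : o.exact (v x a) (v x b) = 0) (y : Fin n → ℂ) (hy : y ∈ W) :
    o.exact (v y a) (v y b) = 0 := by
  cases o with
  | add => exact h.add a b hx y hy
  | sub => exact h.sub a b hx y hy
  | mul =>
    rcases mul_eq_zero.1 hx with h0 | h0
    · exact mul_eq_zero.2 (.inl (h.zero a h0 y hy))
    · exact mul_eq_zero.2 (.inr (h.zero b h0 y hy))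

theorem ZeroRigid.snoc_of_eq_zero {n m : ℕ} {x : Fin n → ℂ} {W : Set (Fin n → ℂ)}
    {v : (Fin n → ℂ) → Fin m → ℂ} (h : ZeroRigid x W v) {w : (Fin n → ℂ) → ℂ}
    (hw : Continuous w) (hx : w x = 0) (h0 : ∀ y ∈ W, w y = 0) :
    ZeroRigid x W fun y => (Fin.snoc (v y) (w y) : Fin (m + 1) → ℂ) := by
  refine ⟨fun b => ?_, fun b => ?_, fun b c => ?_, fun b c => ?_⟩
  · cases b using Fin.lastCases with
    | last => simpa using hw
    | cast b => simpa using h.cont b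
  · cases b using Fin.lastCases with
    | last => simpa using fun _ => h0
    | cast b => simpa using h.zero b
  · intro hbc y hy
    have := h0 y hy
    cases b using Fin.lastCases <;> cases c using Fin.lastCases <;>
      simp_all only [Fin.snoc_last, Fin.snoc_castSucc, add_zero, zero_add]
    · exact h.zero _ hbc y hy
    · exact h.zero _ hbc y hy
    · exact h.add _ _ hbc y hy
  · intro hbc y hy
    have := h0 y hy
    cases b using Fin.lastCases <;> cases c using Fin.lastCases <;>
      simp_all only [Fin.snoc_last, Fin.snoc_castSucc, sub_zero, zero_sub, neg_eq_zero]
    · exact h.zero _ hbc y hy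
    · exact h.zero _ hbc y hy
    · exact h.sub _ _ hbc y hy

/-- The new value takes part in no coincidence at `x` except the trivial difference with itself, so
there is nothing new to check on `W`. -/
theorem ZeroRigid.snoc_of_ne {n m : ℕ} {x : Fin n → ℂ} {W : Set (Fin n → ℂ)}
    {v : (Fin n → ℂ) → Fin m → ℂ} (h : ZeroRigid x W v) {w : (Fin n → ℂ) → ℂ}
    (hw : Continuous w) (hx : w x ≠ 0) (hadd : ∀ b, w x + v x b ≠ 0)
    (hsub : ∀ b, w x - v x b ≠ 0) :
    ZeroRigid x W fun y => (Fin.snoc (v y) (w y) : Fin (m + 1) → ℂ) := by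
  refine ⟨fun b => ?_, fun b => ?_, fun b c => ?_, fun b c => ?_⟩
  · cases b using Fin.lastCases with
    | last => simpa using hw
    | cast b => simpa using h.cont b
  · cases b using Fin.lastCases with
    | last => simpa using fun h' => absurd h' hx
    | cast b => simpa using h.zero b
  · intro hbc y hy
    cases b using Fin.lastCases <;> cases c using Fin.lastCases <;>
      simp only [Fin.snoc_last, Fin.snoc_castSucc] at hbc ⊢
    · exact absurd (by simpa [← two_mul] using hbc) hx
    · exact absurd hbc (hadd _)
    · exact absurd (by rw [add_comm]; exact hbc) (hadd _)
    · exact h.add _ _ hbc y hy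
  · intro hbc y hy
    cases b using Fin.lastCases <;> cases c using Fin.lastCases <;>
      simp only [Fin.snoc_last, Fin.snoc_castSucc] at hbc ⊢
    · simp
    · exact absurd hbc (hsub _)
    · exact absurd (by rw [← neg_sub, hbc, neg_zero]) (hsub _)
    · exact h.sub _ _ hbc y hy

/-- Small numbers avoid any given finite set. -/
theorem exists_norm_le_notMem {ε : ℝ} (hε : 0 < ε) {s : Set ℂ} (hs : s.Finite) :
    ∃ d : ℂ, ‖d‖ ≤ ε ∧ d ∉ s := by
  have hinf : (Metric.closedBall (0 : ℂ) ε).Infinite :=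
    (infinite_of_mem_nhds (0 : ℂ) (Metric.closedBall_mem_nhds 0 hε))
  obtain ⟨d, hd, hds⟩ := hinf.exists_notMem_finite hs
  exact ⟨d, by simpa using hd, hds⟩

/-- A suitable rounding error keeps a family rigid when the result of an operation is appended. -/
theorem ZeroRigid.exists_snoc_arith {n m : ℕ} {x : Fin n → ℂ} {W : Set (Fin n → ℂ)}
    {v : (Fin n → ℂ) → Fin m → ℂ} (h : ZeroRigid x W v) (o : ArithOp) (a b : Fin m)
    {ε : ℝ} (hε : 0 < ε) :
    ∃ d : ℂ, ‖d‖ ≤ ε ∧ ZeroRigid x W fun y =>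
      (Fin.snoc (v y) (o.exact (v y a) (v y b) * (1 + d)) : Fin (m + 1) → ℂ) := by
  have hcont : Continuous fun y => o.exact (v y a) (v y b) := by
    cases o with
    | add => exact (h.cont a).add (h.cont b)
    | sub => exact (h.cont a).sub (h.cont b)
    | mul => exact (h.cont a).mul (h.cont b)
  set w := o.exact (v x a) (v x b) with hw
  by_cases hw0 : w = 0
  · refine ⟨0, by simpa using hε.le, ?_⟩
    refine h.snoc_of_eq_zero (hcont.mul continuous_const) ?_ fun y hy => ?_
    · rw [← hw, hw0, zero_mul]
    · rw [h.exact_eq_zero o a b hw0 y hy, zero_mul]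
  -- The bad errors: those making `w * (1 + d)` zero, or equal up to sign to an earlier value at
  -- `x`.
  · let s : Set ℂ := {-1} ∪ ((Set.range fun c => -(v x c) / w - 1) ∪
      Set.range fun c => v x c / w - 1)
    have hs : s.Finite :=
      (Set.finite_singleton _).union ((Set.finite_range _).union (Set.finite_range _))
    obtain ⟨d, hd, hds⟩ := exists_norm_le_notMem hε hs
    refine ⟨d, hd, h.snoc_of_ne (hcont.mul continuous_const) ?_ (fun c hc => ?_) fun c hc => ?_⟩
    · refine mul_ne_zero hw0 fun h1 => hds (.inl ?_)
      rw [Set.mem_singleton_iff]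
      linear_combination h1
    · refine hds (.inr (.inl ⟨c, ?_⟩))
      rw [← hw] at hc
      field_simp
      linear_combination -hc
    · refine hds (.inr (.inr ⟨c, ?_⟩))
      rw [← hw] at hc
      field_simp
      linear_combination -hc

/-- For suitable small rounding errors, an algorithm coincides along an ultrafilter with a
continuous function that vanishes on `W` if it vanishes at `x`. -/
theorem ZeroRigid.exists_run_eventuallyEq {T : Set (ℂ → ℂ → Prop)} {n m : ℕ} {x : Fin n → ℂ}
    {W : Set (Fin n → ℂ)} (A : Algorithm T m) {v : (Fin n → ℂ) → Fin m → ℂ}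
    (h : ZeroRigid x W v) (U : Ultrafilter (Fin n → ℂ)) {ε : ℝ} (hε : 0 < ε) :
    ∃ δ : ℕ → ℂ, (∀ i, ‖δ i‖ ≤ ε) ∧ ∃ f : (Fin n → ℂ) → ℂ, Continuous f ∧
      (f x = 0 → ∀ y ∈ W, f y = 0) ∧ ∀ᶠ y in (U : Filter (Fin n → ℂ)), A.run δ (v y) = f y := by
  induction A with
  | output a =>
    exact ⟨0, fun _ => by simpa using hε.le, fun y => v y a, h.cont a, h.zero a,
      .of_forall fun y => rfl⟩
  | neg a next ih => exact ih (h.snoc_neg a)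
  | @arith m o a b next ih =>
    obtain ⟨d, hd, h'⟩ := h.exists_snoc_arith o a b hε
    obtain ⟨δ, hδ, f, hf, hf0, hr⟩ := ih h'
    -- The error of index `m` is free: the remaining program reads only indices from `m + 1` on.
    refine ⟨Function.update δ m d, fun i => ?_, f, hf, hf0, ?_⟩
    · rcases eq_or_ne i m with rfl | hi
      · simpa using hd
      · simpa [hi] using hδ i
    · filter_upwards [hr] with y hy
      rw [← hy]
      simp only [Algorithm.run, Function.update_self]
      exact next.run_congr (fun i hi => Function.update_of_ne (by omega) _ _) _
  | branch R hR a b A B ihA ihB =>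
    -- Nothing is known about `R`, but an ultrafilter settles every comparison one way.
    rcases U.em fun y => R (v y a) (v y b) with hU | hU
    · obtain ⟨δ, hδ, f, hf, hf0, hr⟩ := ihA h
      refine ⟨δ, hδ, f, hf, hf0, ?_⟩
      filter_upwards [hU, hr] with y hy hy'
      simp only [Algorithm.run, if_pos hy, hy']
    · obtain ⟨δ, hδ, f, hf, hf0, hr⟩ := ihB h
      refine ⟨δ, hδ, f, hf, hf0, ?_⟩
      filter_upwards [hU, hr] with y hy hy'
      simp only [Algorithm.run, if_neg hy, hy']

/-! ### Necessity: the variety contains the hull of each of its points. -/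

/-- The intersection of the allowable hyperplanes through `x`. -/
def allowableHull {n : ℕ} (x : Fin n → ℂ) : Set (Fin n → ℂ) :=
  ⋂₀ {H ∈ allowableHyperplanes n | x ∈ H}

theorem zeroRigid_allowableHull {n : ℕ} (x : Fin n → ℂ) :
    ZeroRigid x (allowableHull x) fun y => y := by
  have hzero : ∀ a, x a = 0 → ∀ y ∈ allowableHull x, y a = 0 := fun a hx y hy =>
    hy {z | z a = 0} ⟨.inl ⟨a, rfl⟩, hx⟩
  refine ⟨fun a => continuous_apply a, hzero, fun a b hx y hy => ?_, fun a b hx y hy => ?_⟩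
  · rcases eq_or_ne a b with rfl | hab
    · rw [hzero a (by simpa [← two_mul] using hx) y hy, add_zero]
    · exact hy {z | z a + z b = 0} ⟨.inr (.inl ⟨a, b, hab, rfl⟩), hx⟩
  · rcases eq_or_ne a b with rfl | hab
    · exact sub_self _
    · exact hy {z | z a - z b = 0} ⟨.inr (.inr ⟨a, b, hab, rfl⟩), hx⟩

/-- The hull is a linear subspace; this allows `x` to be approached along a line inside it. -/
theorem lineMap_mem_allowableHull {n : ℕ} {x y : Fin n → ℂ} (hy : y ∈ allowableHull x) (t : ℂ) :
    (fun i => x i + t * (y i - x i)) ∈ allowableHull x := by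
  rintro H ⟨hH, hx⟩
  have hyH := hy H ⟨hH, hx⟩
  rcases hH with ⟨i, rfl⟩ | ⟨i, j, -, rfl⟩ | ⟨i, j, -, rfl⟩ <;>
    simp only [Set.mem_ofPred_eq] at hx hyH ⊢
  · linear_combination (1 - t) * hx + t * hyH
  · linear_combination (1 - t) * hx + t * hyH
  · linear_combination (1 - t) * hx + t * hyH

/-- If `p` does not vanish at `y`, then it does not vanish at points of the line from `x` to `y`
close to `x`. -/
theorem eventually_eval_line_ne_zero {n : ℕ} (p : MvPolynomial (Fin n) ℂ) {x y : Fin n → ℂ}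
    (hy : MvPolynomial.eval y p ≠ 0) :
    ∀ᶠ t in 𝓝[≠] (0 : ℂ), MvPolynomial.eval (fun i => x i + t * (y i - x i)) p ≠ 0 := by
  let q : Polynomial ℂ := MvPolynomial.aeval
    (fun i => Polynomial.C (x i) + Polynomial.X * Polynomial.C (y i - x i)) p
  have hq : ∀ t, q.eval t = MvPolynomial.eval (fun i => x i + t * (y i - x i)) p := fun t => by
    simp only [q, MvPolynomial.aeval_def, ← Polynomial.coe_evalRingHom,
      MvPolynomial.hom_eval₂, ← MvPolynomial.eval₂_id]
    congr 1
    · ext; simp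
    · ext i; simp
  have hq0 : q ≠ 0 := by
    rintro h0
    have := hq 1
    simp [h0] at this
    exact hy this.symm
  have hfin : {t | q.IsRoot t}.Finite := Polynomial.finite_setOfPred_isRoot hq0
  have : ({t | q.IsRoot t} \ {0})ᶜ ∈ 𝓝 (0 : ℂ) :=
    (hfin.subset Set.sdiff_subset).isClosed.isOpen_compl.mem_nhds (by simp)
  filter_upwards [nhdsWithin_le_nhds this, self_mem_nhdsWithin] with t ht ht0
  rw [← hq]
  intro h
  exact ht ⟨h, ht0⟩

theorem Algorithm.IsAccurate.allowableHull_subset {T : Set (ℂ → ℂ → Prop)} {n : ℕ}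
    {A : Algorithm T n} {p : MvPolynomial (Fin n) ℂ} (hA : A.IsAccurate p Set.univ)
    {x : Fin n → ℂ} (hx : x ∈ variety p) : allowableHull x ⊆ variety p := by
  intro y hy
  by_contra hpy
  have hline : Tendsto (fun t : ℂ => fun i => x i + t * (y i - x i)) (𝓝[≠] 0) (𝓝 x) := by
    refine tendsto_nhdsWithin_of_tendsto_nhds (Continuous.tendsto' (by fun_prop) _ _ ?_)
    simp
  obtain ⟨ε, hε, -, hacc⟩ := hA.2 (1 / 2) (by norm_num) (by norm_num)
  let U : Ultrafilter (Fin n → ℂ) :=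
    (Ultrafilter.of (𝓝[≠] (0 : ℂ))).map fun t => fun i => x i + t * (y i - x i)
  have hUx : Tendsto id (U : Filter (Fin n → ℂ)) (𝓝 x) := hline.mono_left (Ultrafilter.of_le _)
  have hUp : ∀ᶠ z in (U : Filter (Fin n → ℂ)), MvPolynomial.eval z p ≠ 0 :=
    (Ultrafilter.of_le _) (eventually_eval_line_ne_zero p hpy)
  have hUW : ∀ᶠ z in (U : Filter (Fin n → ℂ)), z ∈ allowableHull x :=
    Eventually.of_forall (f := (Ultrafilter.of (𝓝[≠] (0 : ℂ)) : Filter ℂ))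
      fun t => lineMap_mem_allowableHull hy t
  obtain ⟨δ, hδ, f, hf, hf0, hr⟩ :=
    (zeroRigid_allowableHull x).exists_run_eventuallyEq A U hε
  have hbound : ∀ᶠ z in (U : Filter (Fin n → ℂ)),
      ‖f z - MvPolynomial.eval z p‖ ≤ 1 / 2 * ‖MvPolynomial.eval z p‖ := by
    filter_upwards [hr] with z hz
    rw [← hz]
    exact hacc z trivial δ hδ
  have hp : Tendsto (fun z => MvPolynomial.eval z p) (U : Filter (Fin n → ℂ)) (𝓝 0) := by
    have := ((MvPolynomial.continuous_eval p).tendsto x).comp hUx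
    rwa [show MvPolynomial.eval x p = 0 from hx] at this
  -- In the limit at `x` the accuracy bound reads `‖f x - 0‖ ≤ 0`.
  have hfx : f x = 0 := by
    have hfU : Tendsto f (U : Filter (Fin n → ℂ)) (𝓝 (f x)) := (hf.tendsto x).comp hUx
    have := le_of_tendsto_of_tendsto (hfU.sub hp).norm (hp.norm.const_mul (1 / 2)) hbound
    simpa using this
  obtain ⟨z, ⟨hzb, hzp⟩, hzW⟩ := ((hbound.and hUp).and hUW).exists
  rw [hf0 hfx z hzW, zero_sub, norm_neg] at hzb
  have := norm_pos_iff.2 hzp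
  linarith

theorem AccuratelyEvaluable.isAllowable {T : Set (ℂ → ℂ → Prop)} {n : ℕ}
    {p : MvPolynomial (Fin n) ℂ} (h : AccuratelyEvaluable T p Set.univ) :
    IsAllowable (variety p) := by
  obtain ⟨A, hA⟩ := h
  refine ⟨(fun x => {H ∈ allowableHyperplanes n | x ∈ H}) '' variety p, ?_, ?_⟩
  · rintro _ ⟨x, -, rfl⟩ H hH
    exact hH.1
  · refine subset_antisymm (fun x hx => ?_) ?_
    · exact Set.mem_biUnion (Set.mem_image_of_mem _ hx) fun H hH => hH.2
    · refine Set.iUnion₂_subset ?_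
      rintro _ ⟨x, hx, rfl⟩
      exact hA.allowableHull_subset hx

end AccurateEval

/-! ### Sufficiency: composing accurate straight-line programs. -/

namespace AccurateEval

/-- `f` can be computed by a straight-line program that is accurate wherever it is inserted:
in a state of `m` values, among which the arguments of `f` stand at the places `ι`, the program `Φ`
turns the values `v` into `W δ v`, keeps the old ones, and puts `f` at the place `r`. -/
def StraightLineComputable (T : Set (ℂ → ℂ → Prop)) {n : ℕ} (f : (Fin n → ℂ) → ℂ) : Prop :=
  ∀ (m : ℕ) (ι : Fin n → Fin m), ∃ (m' : ℕ) (h : m ≤ m') (r : Fin m')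
    (Φ : Algorithm T m' → Algorithm T m) (W : (ℕ → ℂ) → (Fin m → ℂ) → Fin m' → ℂ),
    (∀ A δ v, (Φ A).run δ v = A.run δ (W δ v)) ∧
    (∀ δ v a, W δ v (Fin.castLE h a) = v a) ∧
    ∀ η : ℝ, 0 < η → ∃ ε : ℝ, 0 < ε ∧ ∀ δ : ℕ → ℂ, (∀ i, ‖δ i‖ ≤ ε) → ∀ v,
      ‖W δ v r - f (v ∘ ι)‖ ≤ η * ‖f (v ∘ ι)‖

variable {T : Set (ℂ → ℂ → Prop)} {n : ℕ}

theorem StraightLineComputable.accuratelyEvaluable {p : MvPolynomial (Fin n) ℂ}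
    (h : StraightLineComputable T fun x => MvPolynomial.eval x p) :
    AccuratelyEvaluable T p Set.univ := by
  obtain ⟨m, hm, r, Φ, W, hΦ, -, hacc⟩ := h n id
  refine ⟨Φ (.output r), fun x _ => ?_, fun η hη _ => ?_⟩
  · rw [hΦ, Algorithm.run, ← sub_eq_zero, ← norm_le_zero_iff]
    -- Exactness at `δ = 0` follows from the accuracy bound, since zero errors are admissible for
    -- every `η`.
    refine le_of_forall_pos_le_add fun e he => ?_
    obtain ⟨ε, hε, hb⟩ := hacc (e / (‖MvPolynomial.eval x p‖ + 1)) (by positivity)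
    refine (hb 0 (fun _ => by simpa using hε.le) x).trans ?_
    rw [Function.comp_id, zero_add, div_mul_eq_mul_div, div_le_iff₀ (by positivity)]
    nlinarith [norm_nonneg (MvPolynomial.eval x p)]
  · obtain ⟨ε, hε, hb⟩ := hacc η hη
    refine ⟨min ε (1 / 2), by positivity, (min_le_right _ _).trans_lt (by norm_num),
      fun x _ δ hδ => ?_⟩
    rw [hΦ, Algorithm.run]
    exact hb δ (fun i => (hδ i).trans (min_le_left _ _)) x

theorem straightLineComputable_apply (i : Fin n) : StraightLineComputable T fun x => x i :=
  fun m ι => ⟨m, le_rfl, ι i, id, fun _ v => v, fun _ _ _ => rfl, fun _ _ _ => rfl,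
    fun η hη => ⟨1, one_pos, fun δ _ v => by
      simpa using mul_nonneg hη.le (norm_nonneg (v (ι i)))⟩⟩

theorem StraightLineComputable.neg {f : (Fin n → ℂ) → ℂ} (hf : StraightLineComputable T f) :
    StraightLineComputable T fun x => -f x := by
  intro m ι
  obtain ⟨m', h, r, Φ, W, hΦ, hW, hacc⟩ := hf m ι
  refine ⟨m' + 1, by omega, Fin.last m', fun A => Φ (.neg r A),
    fun δ v => Fin.snoc (W δ v) (-(W δ v r)), fun A δ v => by rw [hΦ, Algorithm.run],
    fun δ v a => ?_, fun η hη => ?_⟩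
  · rw [← hW δ v a]
    exact Fin.snoc_castSucc (α := fun _ => ℂ) _ _ (Fin.castLE h a)
  · obtain ⟨ε, hε, hb⟩ := hacc η hη
    refine ⟨ε, hε, fun δ hδ v => ?_⟩
    have := hb δ hδ v
    simp only [Fin.snoc_last]
    rwa [norm_neg, neg_sub_neg, norm_sub_rev]

/-- An operation can be appended to two straight-line programs if it is well conditioned there. -/
theorem StraightLineComputable.exact {f g : (Fin n → ℂ) → ℂ} (hf : StraightLineComputable T f)
    (hg : StraightLineComputable T g) (o : ArithOp)
    (hcond : ∀ η : ℝ, 0 < η → ∃ θ : ℝ, 0 < θ ∧ ∀ (x : Fin n → ℂ) (a b : ℂ),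
      ‖a - f x‖ ≤ θ * ‖f x‖ → ‖b - g x‖ ≤ θ * ‖g x‖ →
        ‖o.exact a b - o.exact (f x) (g x)‖ ≤ η * ‖o.exact (f x) (g x)‖) :
    StraightLineComputable T fun x => o.exact (f x) (g x) := by
  intro m ι
  obtain ⟨m₁, h₁, r₁, Φ₁, W₁, hΦ₁, hW₁, hacc₁⟩ := hf m ι
  -- The program for `g` runs in the state left by that for `f`, where the arguments keep their
  -- places.
  obtain ⟨m₂, h₂, r₂, Φ₂, W₂, hΦ₂, hW₂, hacc₂⟩ := hg m₁ fun i => Fin.castLE h₁ (ι i)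
  refine ⟨m₂ + 1, by omega, Fin.last m₂, fun A => Φ₁ (Φ₂ (.arith o (Fin.castLE h₂ r₁) r₂ A)),
    fun δ v => Fin.snoc (W₂ δ (W₁ δ v)) (o.exact (W₁ δ v r₁) (W₂ δ (W₁ δ v) r₂) * (1 + δ m₂)),
    fun A δ v => by rw [hΦ₁, hΦ₂, Algorithm.run, hW₂], fun δ v a => ?_, fun η hη => ?_⟩
  · rw [← hW₁ δ v a, ← hW₂ δ (W₁ δ v) (Fin.castLE h₁ a)]
    exact Fin.snoc_castSucc (α := fun _ => ℂ) _ _ (Fin.castLE h₂ (Fin.castLE h₁ a))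
  -- The bound 1 gives `‖w‖ ≤ 2 * ‖z‖`, so the final rounding costs at most two thirds of `η`, and
  -- the operands the other third.
  · obtain ⟨θ, hθ, hc⟩ := hcond (min (η / 3) 1) (by positivity)
    obtain ⟨ε₁, hε₁, hb₁⟩ := hacc₁ θ hθ
    obtain ⟨ε₂, hε₂, hb₂⟩ := hacc₂ θ hθ
    refine ⟨min (min ε₁ ε₂) (η / 3), by positivity, fun δ hδ v => ?_⟩
    have hv : W₁ δ v ∘ (fun i => Fin.castLE h₁ (ι i)) = v ∘ ι := funext fun i => hW₁ δ v (ι i)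
    have h1 := hb₁ δ (fun i => (hδ i).trans ((min_le_left _ _).trans (min_le_left _ _))) v
    have h2 := hb₂ δ (fun i => (hδ i).trans ((min_le_left _ _).trans (min_le_right _ _))) (W₁ δ v)
    have h3 : ‖δ m₂‖ ≤ η / 3 := (hδ m₂).trans (min_le_right _ _)
    rw [hv] at h2
    have h4 := hc (v ∘ ι) _ _ h1 h2
    simp only [Fin.snoc_last]
    generalize o.exact (W₁ δ v r₁) (W₂ δ (W₁ δ v) r₂) = w at h4 ⊢
    generalize o.exact (f (v ∘ ι)) (g (v ∘ ι)) = z at h4 ⊢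
    have h5 : ‖w - z‖ ≤ η / 3 * ‖z‖ := h4.trans (by gcongr; exact min_le_left _ _)
    have h6 : ‖w - z‖ ≤ 1 * ‖z‖ := h4.trans (by gcongr; exact min_le_right _ _)
    have h7 : ‖w‖ ≤ 2 * ‖z‖ := by
      have := norm_add_le (w - z) z
      rw [sub_add_cancel] at this
      linarith
    calc ‖w * (1 + δ m₂) - z‖ = ‖(w - z) + w * δ m₂‖ := by ring_nf
      _ ≤ ‖w - z‖ + ‖w‖ * ‖δ m₂‖ := (norm_add_le _ _).trans_eq (by rw [norm_mul])
      _ ≤ η / 3 * ‖z‖ + 2 * ‖z‖ * (η / 3) := by gcongr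
      _ = η * ‖z‖ := by ring

theorem StraightLineComputable.mul {f g : (Fin n → ℂ) → ℂ} (hf : StraightLineComputable T f)
    (hg : StraightLineComputable T g) : StraightLineComputable T fun x => f x * g x := by
  refine hf.exact hg .mul fun η hη => ⟨min (η / 3) 1, by positivity, fun x a b ha hb => ?_⟩
  simp only [ArithOp.exact]
  set θ := min (η / 3) 1
  have hθ : 0 < θ := by positivity
  have hθ1 : θ ≤ 1 := min_le_right _ _
  have hθη : θ ≤ η / 3 := min_le_left _ _
  calc ‖a * b - f x * g x‖
      = ‖(a - f x) * (b - g x) + (a - f x) * g x + f x * (b - g x)‖ := by ring_nf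
    _ ≤ ‖a - f x‖ * ‖b - g x‖ + ‖a - f x‖ * ‖g x‖ + ‖f x‖ * ‖b - g x‖ := by
      simpa only [norm_mul] using norm_add₃_le
        (a := (a - f x) * (b - g x)) (b := (a - f x) * g x) (c := f x * (b - g x))
    _ ≤ (θ * ‖f x‖) * (1 * ‖g x‖) + (θ * ‖f x‖) * ‖g x‖ + ‖f x‖ * (θ * ‖g x‖) := by
      gcongr
      exact hb.trans (by gcongr)
    _ = 3 * θ * ‖f x * g x‖ := by rw [norm_mul]; ring
    _ ≤ η * ‖f x * g x‖ := by gcongr; linarith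

/-- Repeated addition is well conditioned here: `k * f x` and `f x` are nonnegative multiples of one
number, so they cannot cancel. -/
theorem StraightLineComputable.natMul {f : (Fin n → ℂ) → ℂ} (hf : StraightLineComputable T f)
    {k : ℕ} (hk : 1 ≤ k) : StraightLineComputable T fun x => (k : ℂ) * f x := by
  induction k, hk using Nat.le_induction with
  | base => simpa using hf
  | succ k hk ih =>
    have := ih.exact hf .add fun η hη => ⟨η, hη, fun x a b ha hb => ?_⟩
    · simpa [ArithOp.exact, add_mul] using this
    · simp only [ArithOp.exact]
      rw [norm_mul, Complex.norm_natCast] at ha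
      calc ‖a + b - (k * f x + f x)‖ = ‖(a - k * f x) + (b - f x)‖ := by ring_nf
        _ ≤ η * (k * ‖f x‖) + η * ‖f x‖ := (norm_add_le _ _).trans (add_le_add ha hb)
        _ = η * (‖((k + 1 : ℕ) : ℂ)‖ * ‖f x‖) := by
          rw [Complex.norm_natCast]; push_cast; ring
        _ = η * ‖k * f x + f x‖ := by
          rw [← norm_mul]; push_cast; ring_nf

/-- An operation on exactly known inputs. -/
theorem straightLineComputable_exact_apply (o : ArithOp) (i j : Fin n) :
    StraightLineComputable T fun x => o.exact (x i) (x j) := by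
  intro m ι
  refine ⟨m + 1, by omega, Fin.last m, .arith o (ι i) (ι j),
    fun δ v => Fin.snoc v (o.exact (v (ι i)) (v (ι j)) * (1 + δ m)), fun A δ v => rfl,
    fun δ v a => Fin.snoc_castSucc (α := fun _ => ℂ) _ _ a,
    fun η hη => ⟨η, hη, fun δ hδ v => ?_⟩⟩
  simp only [Fin.snoc_last, Function.comp_apply, mul_add, mul_one, add_sub_cancel_left, norm_mul]
  rw [mul_comm]
  gcongr
  exact hδ m

theorem StraightLineComputable.intMul {f : (Fin n → ℂ) → ℂ} (hf : StraightLineComputable T f)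
    {c : ℤ} (hc : c ≠ 0) : StraightLineComputable T fun x => (c : ℂ) * f x := by
  have h := hf.natMul (Int.natAbs_pos.2 hc)
  rcases Int.natAbs_eq c with hc' | hc'
  · rw [hc']
    simpa using h
  · rw [hc']
    simpa using h.neg

theorem straightLineComputable_zero (hn : 0 < n) :
    StraightLineComputable T fun _ : Fin n → ℂ => 0 := by
  simpa [ArithOp.exact] using straightLineComputable_exact_apply (T := T) .sub ⟨0, hn⟩ ⟨0, hn⟩

/-- The products of straight-line computable polynomials, the empty product included. -/
def straightLineSubmonoid (T : Set (ℂ → ℂ → Prop)) (n : ℕ) :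
    Submonoid (MvPolynomial (Fin n) ℂ) where
  -- The unit is adjoined by hand, since programs have no constants.
  carrier := {q | q = 1 ∨ StraightLineComputable T fun x => MvPolynomial.eval x q}
  one_mem' := .inl rfl
  mul_mem' := by
    rintro p q (rfl | hp) (rfl | hq)
    · exact .inl (mul_one 1)
    · exact .inr (by simpa using hq)
    · exact .inr (by simpa using hp)
    · exact .inr (by simpa using hp.mul hq)

/-- The product of coordinates and of sums and differences of two coordinates with the given
exponents. -/
noncomputable def formProd (a : Fin n → ℕ) (s d : Fin n → Fin n → ℕ) :
    MvPolynomial (Fin n) ℂ :=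
  (∏ i, MvPolynomial.X i ^ a i) * ∏ i, ∏ j ∈ Finset.Ioi i,
    ((MvPolynomial.X i + MvPolynomial.X j) ^ s i j *
      (MvPolynomial.X i - MvPolynomial.X j) ^ d i j)

theorem formProd_mem_straightLineSubmonoid (a : Fin n → ℕ) (s d : Fin n → Fin n → ℕ) :
    formProd a s d ∈ straightLineSubmonoid T n := by
  have hX : ∀ i, MvPolynomial.X i ∈ straightLineSubmonoid T n := fun i =>
    Or.inr (by simpa using straightLineComputable_apply i)
  have hadd : ∀ i j, MvPolynomial.X i + MvPolynomial.X j ∈ straightLineSubmonoid T n := fun i j =>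
    Or.inr (by simpa [ArithOp.exact] using straightLineComputable_exact_apply (T := T) .add i j)
  have hsub : ∀ i j, MvPolynomial.X i - MvPolynomial.X j ∈ straightLineSubmonoid T n := fun i j =>
    Or.inr (by simpa [ArithOp.exact] using straightLineComputable_exact_apply (T := T) .sub i j)
  exact mul_mem (prod_mem fun i _ => pow_mem (hX i) _) (prod_mem fun i _ => prod_mem fun j _ =>
    mul_mem (pow_mem (hadd i j) _) (pow_mem (hsub i j) _))

theorem accuratelyEvaluable_of_eq_formProd (hn : 0 < n) {p : MvPolynomial (Fin n) ℂ}
    (hzero : MvPolynomial.constantCoeff p = 0) {c : ℤ} {a : Fin n → ℕ}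
    {s d : Fin n → Fin n → ℕ} (hp : p = MvPolynomial.C (c : ℂ) * formProd a s d) :
    AccuratelyEvaluable T p Set.univ := by
  apply StraightLineComputable.accuratelyEvaluable
  rcases eq_or_ne c 0 with rfl | hc
  · simpa [hp] using straightLineComputable_zero hn
  · rcases formProd_mem_straightLineSubmonoid (T := T) a s d with h | h
    -- If the product is 1, then `p` is the nonzero constant `c`, which the zero constant term
    -- excludes.
    · rw [hp, h] at hzero
      simp [hc] at hzero
    · simpa [hp] using h.intMul hc

end AccurateEval

/-! ### Polynomials with allowable variety: factorization into linear forms. -/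

namespace AccurateEval

variable {n : ℕ}

theorem formProd_mul (a a' : Fin n → ℕ) (s s' d d' : Fin n → Fin n → ℕ) :
    formProd a s d * formProd a' s' d' = formProd (a + a') (s + s') (d + d') := by
  simp only [formProd, Pi.add_apply, pow_add, Finset.prod_mul_distrib]
  ring

theorem formProd_single_coord (i : Fin n) :
    formProd (Pi.single i 1) 0 0 = MvPolynomial.X i := by
  simp [formProd, Pi.single_apply, pow_ite]

theorem formProd_single_add {i j : Fin n} (h : i < j) :
    formProd 0 (Pi.single i (Pi.single j 1)) 0 = MvPolynomial.X i + MvPolynomial.X j := by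
  simp only [formProd, Pi.zero_apply, pow_zero, Finset.prod_const_one, one_mul, mul_one]
  rw [Finset.prod_eq_single i, Finset.prod_eq_single j]
  · simp
  · intro k _ hk
    simp [hk]
  · simp [h]
  · intro k _ hk
    simp [hk]
  · simp

theorem formProd_single_sub {i j : Fin n} (h : i < j) :
    formProd 0 0 (Pi.single i (Pi.single j 1)) = MvPolynomial.X i - MvPolynomial.X j := by
  simp only [formProd, Pi.zero_apply, pow_zero, Finset.prod_const_one, one_mul]
  rw [Finset.prod_eq_single i, Finset.prod_eq_single j]
  · simp
  · intro k _ hk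
    simp [hk]
  · simp [h]
  · intro k _ hk
    simp [hk]
  · simp

theorem degree_X_lt_degree_X {i j : Fin n} (h : i < j) :
    MonomialOrder.lex.toSyn (MonomialOrder.lex.degree (MvPolynomial.X j : MvPolynomial (Fin n) ℂ)) <
      MonomialOrder.lex.toSyn
        (MonomialOrder.lex.degree (MvPolynomial.X i : MvPolynomial (Fin n) ℂ)) := by
  rw [MonomialOrder.degree_X, MonomialOrder.degree_X, MonomialOrder.lex_lt_iff]
  exact Finsupp.Lex.single_lt_iff.2 h

theorem monic_X_add_X {i j : Fin n} (h : i < j) :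
    MonomialOrder.lex.Monic (MvPolynomial.X i + MvPolynomial.X j : MvPolynomial (Fin n) ℂ) :=
  MonomialOrder.monic_X.add_of_lt (degree_X_lt_degree_X h)

theorem monic_X_sub_X {i j : Fin n} (h : i < j) :
    MonomialOrder.lex.Monic (MvPolynomial.X i - MvPolynomial.X j : MvPolynomial (Fin n) ℂ) :=
  (MonomialOrder.leadingCoeff_sub_of_lt (degree_X_lt_degree_X h)).trans MonomialOrder.monic_X

/-- For `i < j` the leading term of each binomial factor is `X i`, with coefficient 1. This is what
makes the scalar in front of the product readable as a coefficient. -/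
theorem monic_formProd (a : Fin n → ℕ) (s d : Fin n → Fin n → ℕ) :
    MonomialOrder.lex.Monic (formProd a s d) := by
  refine (MonomialOrder.Monic.prod fun i _ => MonomialOrder.monic_X.pow).mul
    (MonomialOrder.Monic.prod fun i _ => MonomialOrder.Monic.prod fun j hj => ?_)
  have hij := Finset.mem_Ioi.1 hj
  exact (monic_X_add_X hij).pow.mul (monic_X_sub_X hij).pow

theorem irreducible_of_isHomogeneous_one {σ k : Type*} [Field k] {q : MvPolynomial σ k}
    (hq : q.IsHomogeneous 1) (h0 : q ≠ 0) : Irreducible q := by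
  refine MvPolynomial.irreducible_of_totalDegree_eq_one (hq.totalDegree h0) fun x hx => ?_
  obtain ⟨m, hm⟩ := MvPolynomial.ne_zero_iff.1 h0
  exact isUnit_iff_ne_zero.2 fun hx0 => hm (zero_dvd_iff.1 (hx0 ▸ hx m))

theorem exists_eq_C_mul_of_associated {σ k : Type*} [Field k] {q f : MvPolynomial σ k}
    (h : Associated q f) : ∃ c, q = MvPolynomial.C c * f := by
  obtain ⟨u, hu⟩ := h.symm
  obtain ⟨c, -, hc⟩ := MvPolynomial.isUnit_iff_eq_C_of_isReduced.1 u.isUnit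
  exact ⟨c, by rw [← hu, hc, mul_comm]⟩

/-- `formProd 1 1 1` is the product of all the forms, each irreducible, so a prime divisor is
associated to one of them. -/
theorem exists_eq_C_mul_formProd_of_prime {q : MvPolynomial (Fin n) ℂ} (hq : Prime q)
    (h : q ∣ formProd 1 1 1) : ∃ (c : ℂ) (a : Fin n → ℕ) (s d : Fin n → Fin n → ℕ),
      q = MvPolynomial.C c * formProd a s d := by
  have key : ∀ f : MvPolynomial (Fin n) ℂ, f.IsHomogeneous 1 → f ≠ 0 → q ∣ f →
      ∃ c, q = MvPolynomial.C c * f := fun f hf hf0 hqf =>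
    exists_eq_C_mul_of_associated
      (hq.irreducible.associated_of_dvd (irreducible_of_isHomogeneous_one hf hf0) hqf)
  simp only [formProd, Pi.one_apply, pow_one] at h
  rcases hq.dvd_or_dvd h with h | h
  · obtain ⟨i, -, hi⟩ := (hq.dvd_finsetProd_iff _).1 h
    obtain ⟨c, hc⟩ := key _ (MvPolynomial.isHomogeneous_X _ _) (MvPolynomial.X_ne_zero i) hi
    exact ⟨c, _, _, _, by rw [formProd_single_coord, hc]⟩
  · obtain ⟨i, -, hi⟩ := (hq.dvd_finsetProd_iff _).1 h
    obtain ⟨j, hj, hij⟩ := (hq.dvd_finsetProd_iff _).1 hi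
    have hlt := Finset.mem_Ioi.1 hj
    rcases hq.dvd_or_dvd hij with h | h
    · obtain ⟨c, hc⟩ := key _ ((MvPolynomial.isHomogeneous_X _ _).add
        (MvPolynomial.isHomogeneous_X _ _)) (monic_X_add_X hlt).ne_zero h
      exact ⟨c, _, _, _, by rw [formProd_single_add hlt, hc]⟩
    · obtain ⟨c, hc⟩ := key _ ((MvPolynomial.isHomogeneous_X _ _).sub
        (MvPolynomial.isHomogeneous_X _ _)) (monic_X_sub_X hlt).ne_zero h
      exact ⟨c, _, _, _, by rw [formProd_single_sub hlt, hc]⟩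

theorem exists_eq_C_mul_formProd_of_dvd_pow {p : MvPolynomial (Fin n) ℂ} {k : ℕ}
    (h : p ∣ formProd 1 1 1 ^ k) : ∃ (c : ℂ) (a : Fin n → ℕ) (s d : Fin n → Fin n → ℕ),
      p = MvPolynomial.C c * formProd a s d := by
  induction p using UniqueFactorizationMonoid.induction_on_prime with
  | h₁ => exact ⟨0, 0, 0, 0, by simp⟩
  | h₂ u hu =>
    obtain ⟨c, -, rfl⟩ := MvPolynomial.isUnit_iff_eq_C_of_isReduced.1 hu
    exact ⟨c, 0, 0, 0, by simp [formProd]⟩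
  | h₃ r q _ hq ih =>
    obtain ⟨c, a, s, d, hr⟩ := ih ((dvd_mul_left _ _).trans h)
    obtain ⟨c', a', s', d', hq'⟩ := exists_eq_C_mul_formProd_of_prime hq
      (hq.dvd_of_dvd_pow ((dvd_mul_right _ _).trans h))
    refine ⟨c' * c, a' + a, s' + s, d' + d, ?_⟩
    rw [hr, hq', ← formProd_mul, MvPolynomial.C_mul]
    ring

theorem eval_formProd_one_eq_zero {H : Set (Fin n → ℂ)} (hH : H ∈ allowableHyperplanes n)
    {x : Fin n → ℂ} (hx : x ∈ H) : MvPolynomial.eval x (formProd 1 1 1) = 0 := by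
  simp only [formProd, Pi.one_apply, pow_one, map_mul, map_prod, map_add, map_sub,
    MvPolynomial.eval_X, mul_eq_zero, Finset.prod_eq_zero_iff, Finset.mem_univ, true_and,
    Finset.mem_Ioi]
  rcases hH with ⟨i, rfl⟩ | ⟨i, j, hij, rfl⟩ | ⟨i, j, hij, rfl⟩ <;> rw [Set.mem_ofPred_eq] at hx
  · exact .inl ⟨i, hx⟩
  · rcases lt_or_gt_of_ne hij with h | h
    · exact .inr ⟨i, j, h, .inl hx⟩
    · exact .inr ⟨j, i, h, .inl (by rw [add_comm, hx])⟩
  · rcases lt_or_gt_of_ne hij with h | h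
    · exact .inr ⟨i, j, h, .inr hx⟩
    · exact .inr ⟨j, i, h, .inr (by rw [← neg_sub, hx, neg_zero])⟩

theorem IsAllowable.exists_dvd_pow {p : MvPolynomial (Fin n) ℂ} (hp : p ≠ 0)
    (h : IsAllowable (variety p)) : ∃ k : ℕ, p ∣ formProd 1 1 1 ^ k := by
  obtain ⟨F, hF, hV⟩ := h
  have hvan : formProd 1 1 1 ∈ MvPolynomial.vanishingIdeal ℂ
      (MvPolynomial.zeroLocus ℂ (Ideal.span {p})) := by
    intro x hx
    have hxV : x ∈ variety p := hx p (Ideal.mem_span_singleton_self p)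
    rw [hV] at hxV
    obtain ⟨W, hWF, hxW⟩ := Set.mem_iUnion₂.1 hxV
    -- An empty intersection would put the whole space into the variety and force `p = 0`.
    obtain ⟨H, hH⟩ : W.Nonempty := by
      rw [Set.nonempty_iff_ne_empty]
      rintro rfl
      refine hp (MvPolynomial.funext fun y => ?_)
      have hy : y ∈ variety p := hV ▸ Set.mem_biUnion hWF (by simp)
      rw [map_zero]
      exact hy
    exact eval_formProd_one_eq_zero (hF W hWF hH) (hxW H hH)
  -- The Nullstellensatz.
  rw [MvPolynomial.vanishingIdeal_zeroLocus_eq_radical] at hvan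
  obtain ⟨k, hk⟩ := hvan
  exact ⟨k, Ideal.mem_span_singleton.1 hk⟩

theorem IsAllowable.exists_eq_C_mul_formProd {p : MvPolynomial (Fin n) ℂ}
    (hint : ∀ m, ∃ k : ℤ, p.coeff m = (k : ℂ)) (h : IsAllowable (variety p)) :
    ∃ (c : ℤ) (a : Fin n → ℕ) (s d : Fin n → Fin n → ℕ),
      p = MvPolynomial.C (c : ℂ) * formProd a s d := by
  rcases eq_or_ne p 0 with rfl | hp
  · exact ⟨0, 0, 0, 0, by simp⟩
  obtain ⟨k, hk⟩ := h.exists_dvd_pow hp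
  obtain ⟨c, a, s, d, hc⟩ := exists_eq_C_mul_formProd_of_dvd_pow hk
  -- At the leading monomial of the monic product, the coefficient of `p` is `c` itself.
  obtain ⟨z, hz⟩ := hint (MonomialOrder.lex.degree (formProd a s d))
  rw [hc, MvPolynomial.coeff_C_mul, (monic_formProd a s d).coeff_degree, mul_one] at hz
  exact ⟨z, a, s, d, by rw [← hz, hc]⟩

end AccurateEval

theorem mainTheorem2 {n : ℕ} (hn : 0 < n) (p : MvPolynomial (Fin n) ℂ)
    (hint : ∀ m, ∃ k : ℤ, p.coeff m = (k : ℂ)) (hzero : MvPolynomial.constantCoeff p = 0) :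
    (∀ T : Set (ℂ → ℂ → Prop),
      AccurateEval.AccuratelyEvaluable T p Set.univ ↔
        AccurateEval.IsAllowable (AccurateEval.variety p)) ∧
    (AccurateEval.IsAllowable (AccurateEval.variety p) →
      ∃ (c : ℤ) (a : Fin n → ℕ) (s d : Fin n → Fin n → ℕ),
        p = MvPolynomial.C (c : ℂ) * (∏ i, MvPolynomial.X i ^ a i) *
          ∏ i, ∏ j ∈ Finset.Ioi i,
            ((MvPolynomial.X i + MvPolynomial.X j) ^ s i j *
              (MvPolynomial.X i - MvPolynomial.X j) ^ d i j)) := by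
  refine ⟨fun T => ⟨fun h => h.isAllowable, fun h => ?_⟩, fun h => ?_⟩
  · obtain ⟨c, a, s, d, hp⟩ := h.exists_eq_C_mul_formProd hint
    exact AccurateEval.accuratelyEvaluable_of_eq_formProd hn hzero hp
  · obtain ⟨c, a, s, d, hp⟩ := h.exists_eq_C_mul_formProd hint
    exact ⟨c, a, s, d, by rw [hp, AccurateEval.formProd, mul_assoc]⟩
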